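/- Let $p$ be an odd prime, let $F$ be a finite field of characteristic $p$ and order $q=p^n$, and let $d=(q+1)/2$. 1. $d\equiv 1 \pmod{p-1}$ if and only if $n$ is even. 2. $\gcd(d,q-1)=1$ if and only if $q\equiv 1\pmod 4$. 3. If $\gcd(d,q-1)=1$, then $V_{F,d}=n/2$, where $$V_{F,d}=\min_{a\in F}\operatorname{val}_p\bigl(W_{F,d}(a)\bigr),\qquad W_{F,d}(a)=\sum_{x\in F}\psi(x^d-ax).$$ Here $\psi(x)=e^{2\pi i\operatorname{Tr}(x)/p}$ is the canonical additive character of $F$, with $\operatorname{Tr}\colon F\to\mathbb{F}_p$ the absolute trace, and $\operatorname{val}_p$ is the extension of the $p$-adic valuation of $\mathbb{Q}$ to $\mathbb{Q}(e^{2\pi i/p})$ (a field that contains all $W_{F,d}(a)$), so that $\operatorname{val}_p(1-e^{2\pi i/p})=1/(p-1)$ and $\operatorname{val}_p(0)=\infty$. -/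

import Mathlib

open scoped NumberField

noncomputable section

namespace WeilBinomial

/-- The complex number `e^{2πi/p}`. -/
def zeta (p : ℕ) : ℂ := Complex.exp (2 * Real.pi * Complex.I / p)

/-- The subfield `ℚ(e^{2πi/p})` of `ℂ`. -/
def cyclo (p : ℕ) : IntermediateField ℚ ℂ := IntermediateField.adjoin ℚ {zeta p}

theorem zeta_mem (p : ℕ) : zeta p ∈ cyclo p :=
  IntermediateField.subset_adjoin ℚ _ (Set.mem_singleton _)

/-- `e^{2πi/p}` as an element of `ℚ(e^{2πi/p})`. -/
def zetaK (p : ℕ) : cyclo p := ⟨zeta p, zeta_mem p⟩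

section

variable (p : ℕ) [hp : Fact p.Prime]

theorem zeta_isPrimitiveRoot : IsPrimitiveRoot (zeta p) p :=
  Complex.isPrimitiveRoot_exp p hp.out.ne_zero

theorem zetaK_isPrimitiveRoot : IsPrimitiveRoot (zetaK p) p :=
  IsPrimitiveRoot.coe_submonoidClass_iff.mp (zeta_isPrimitiveRoot p)

instance cyclo_isCyclotomicExtension : IsCyclotomicExtension {p} ℚ (cyclo p) := by
  have hint : IsIntegral ℚ (zeta p) := (zeta_isPrimitiveRoot p).isIntegral hp.out.pos |>.tower_top
  change IsCyclotomicExtension {p} ℚ (IntermediateField.adjoin ℚ {zeta p}).toSubalgebra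
  rw [IntermediateField.adjoin_simple_toSubalgebra_of_isAlgebraic hint.isAlgebraic]
  exact (zeta_isPrimitiveRoot p).adjoin_isCyclotomicExtension ℚ

instance cyclo_numberField : NumberField (cyclo p) :=
  IsCyclotomicExtension.numberField {p} ℚ (cyclo p)

/-- `e^{2πi/p} - 1` as an element of the ring of integers of `ℚ(e^{2πi/p})`. -/
def zetaSubOne : 𝓞 (cyclo p) := (zetaK_isPrimitiveRoot p).toInteger - 1

theorem zetaSubOne_prime : Prime (zetaSubOne p) :=
  (zetaK_isPrimitiveRoot p).zeta_sub_one_prime'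

/-- The prime ideal of the ring of integers of `ℚ(e^{2πi/p})` generated by `e^{2πi/p} - 1`;
it is the only prime ideal above `p`. -/
def primeAbove : IsDedekindDomain.HeightOneSpectrum (𝓞 (cyclo p)) where
  asIdeal := Ideal.span {zetaSubOne p}
  isPrime := (Ideal.span_singleton_prime (zetaSubOne_prime p).ne_zero).mpr (zetaSubOne_prime p)
  ne_bot := by simpa using (zetaSubOne_prime p).ne_zero

open Classical in
/-- The extension of the `p`-adic valuation from `ℚ` to `ℚ(e^{2πi/p})`, normalized so that
`1 - e^{2πi/p}` has valuation `1/(p-1)`; the valuation of `0` is `⊤`.  It is the exponent of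
`primeAbove p` in `x`, divided by `p - 1`. (Mathlib's `HeightOneSpectrum.valuation` is
multiplicative: its value at `x ≠ 0` is `exp (-e)`, where `e` is that exponent.) -/
def valp (x : cyclo p) : WithTop ℚ :=
  if x = 0 then ⊤
  else ((-((WithZero.log ((primeAbove p).valuation (cyclo p) x) : ℤ) : ℚ) / ((p : ℚ) - 1) : ℚ) :
    WithTop ℚ)

/-- The normalization of `valp`. -/
theorem valp_one_sub_zetaK : valp p (1 - zetaK p) = ((1 / ((p : ℚ) - 1) : ℚ) : WithTop ℚ) := by
  have h0 : (1 - zetaK p) ≠ 0 := fun h =>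
    (zetaK_isPrimitiveRoot p).ne_one hp.out.one_lt (sub_eq_zero.mp h).symm
  have hv : (primeAbove p).valuation (cyclo p) (1 - zetaK p) = WithZero.exp (-1 : ℤ) := by
    rw [Valuation.map_sub_swap]
    have : zetaK p - 1 = algebraMap (𝓞 (cyclo p)) (cyclo p) (zetaSubOne p) := by
      rw [zetaSubOne, map_sub, map_one]
      rfl
    rw [this, IsDedekindDomain.HeightOneSpectrum.valuation_of_algebraMap]
    exact (primeAbove p).intValuation_singleton (zetaSubOne_prime p).ne_zero rfl
  rw [valp, if_neg h0, hv]
  simp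

variable {F : Type*} [Field F] [Algebra (ZMod p) F]

/-- The canonical additive character `ψ(x) = e^{2πi Tr(x)/p}` of a finite field `F` of
characteristic `p`, where `Tr : F → 𝔽_p` is the absolute trace. -/
def canonicalChar (x : F) : ℂ :=
  Complex.exp (2 * Real.pi * Complex.I * ((Algebra.trace (ZMod p) F x).val : ℂ) / p)

/-- The Weil sum `W_{F,d}(a) = ∑_{x ∈ F} ψ(x^d - a x)`. -/
def weilSum [Fintype F] (d : ℕ) (a : F) : ℂ := ∑ x : F, canonicalChar p (x ^ d - a * x)

theorem weilSum_mem [Fintype F] (d : ℕ) (a : F) : weilSum p d a ∈ cyclo p := by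
  refine sum_mem fun x _ => ?_
  have h : canonicalChar p (x ^ d - a * x) =
      zeta p ^ (Algebra.trace (ZMod p) F (x ^ d - a * x)).val := by
    rw [canonicalChar, zeta, ← Complex.exp_nat_mul]
    congr 1
    ring
  rw [h]
  exact pow_mem (zeta_mem p) _

variable (F) in
/-- `V_{F,d} = min_{a ∈ F} val_p (W_{F,d}(a))`. -/
def V [Fintype F] (d : ℕ) : WithTop ℚ :=
  Finset.univ.inf' Finset.univ_nonempty fun a : F => valp p ⟨weilSum p d a, weilSum_mem p d a⟩

end

end WeilBinomial

end

/-!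
Let `η` be the quadratic character of `F` and `G` its Gauss sum with respect to the canonical
additive character `ψ`. By Euler's criterion `x ^ d = η(x) x` for `d = (q + 1) / 2`, so on squares
`ψ(x ^ d - a x) = ψ((1 - a) x)` and on nonsquares it equals `ψ(-(1 + a) x)`. Detecting squares by
`(1 + η(x)) / 2` gives, for every `a`,
`2 W(a) = q [a = 1] + q [a = -1] + (η(1 - a) - η(-1 - a)) G` (`two_mul_sum_addChar_half`).

Let `v` be the valuation at the prime above `p`. It is trivial on `2`, and `G ^ 2 = η(-1) q` shows
`v(G) ^ 2 = v(q)`. Since `v(q) < v(G)`, every `W(a)` is at least as divisible as `G`, while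
`2 W(1) = q - η(-2) G` has exactly the valuation of `G`. Hence the minimum is `val_p(G) = n / 2`,
where the normalization is the factorization `p ~ (ζ - 1) ^ (p - 1)`.

The two congruence criteria are elementary: `(q - 1) / (p - 1) = 1 + p + ⋯ + p ^ (n - 1)` has the
parity of `n`, and a common divisor of `(q + 1) / 2` and `q - 1` divides `2`.
-/

namespace WeilBinomial

/-- With `s = 1 + p + ⋯ + p ^ (n - 1)`, a sum of `n` odd terms, `(p ^ n + 1) / 2 - 1` is
`s (p - 1) / 2`, which is divisible by `p - 1` exactly when `s` is even. -/
theorem half_succ_pow_modEq_one_iff {p : ℕ} (hp : Odd p) (hp1 : 1 < p) (n : ℕ) :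
    (p ^ n + 1) / 2 ≡ 1 [MOD p - 1] ↔ Even n := by
  set s := ∑ i ∈ Finset.range n, p ^ i with hs
  have hgeom : s * (p - 1) + 1 = p ^ n := by
    have h := geom_sum_mul_add (p - 1) n
    rwa [Nat.sub_add_cancel hp1.le] at h
  have hpar : Even s ↔ Even n := by
    rw [hs, Finset.even_sum_iff_even_card_odd]
    simp [Finset.filter_true_of_mem, hp.pow]
  obtain ⟨m, rfl⟩ := hp
  have hm : m ≠ 0 := by omega
  have hd : ((2 * m + 1) ^ n + 1) / 2 = s * m + 1 := by
    rw [← hgeom, Nat.add_sub_cancel, show s * (2 * m) + 1 + 1 = 2 * (s * m + 1) by ring]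
    simp
  rw [hd, ← hpar, Nat.add_sub_cancel, even_iff_two_dvd, Nat.ModEq.comm,
    Nat.modEq_iff_dvd' (by omega), Nat.add_sub_cancel]
  exact Nat.mul_dvd_mul_iff_right (Nat.pos_of_ne_zero hm)

theorem gcd_half_succ_eq_one_iff {q : ℕ} (hq : Odd q) :
    Nat.gcd ((q + 1) / 2) (q - 1) = 1 ↔ q ≡ 1 [MOD 4] := by
  obtain ⟨k, rfl⟩ := hq
  rw [show (2 * k + 1 + 1) / 2 = k + 1 by omega, Nat.add_sub_cancel,
    Nat.ModEq, ← Nat.Coprime, Nat.coprime_mul_iff_right, Nat.coprime_two_right]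
  simp [Nat.odd_iff]
  omega

/-! ### Weil sums of exponent `(q + 1) / 2` and quadratic Gauss sums -/

section GaussSum

variable {F K : Type*} [Field F] [Fintype F] [CommRing K]

variable (F K) in
/-- The quadratic character of `F` with values in `K`. -/
def quadChar [DecidableEq F] : MulChar F K := (quadraticChar F).ringHomComp (Int.castRingHom K)

theorem quadChar_isQuadratic [DecidableEq F] : (quadChar F K).IsQuadratic :=
  (quadraticChar_isQuadratic F).comp _

theorem quadChar_ne_one [DecidableEq F] [CharZero K] (hF : ringChar F ≠ 2) : quadChar F K ≠ 1 :=
  (MulChar.ringHomComp_ne_one_iff (RingHom.injective_int _)).mpr (quadraticChar_ne_one hF)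

variable [IsDomain K]

/-- The Gauss sum identity at an arbitrary shift; the shift `0` is allowed when `χ ≠ 1`. -/
theorem sum_mulChar_mul_addChar_mul {χ : MulChar F K} (hχ : χ ≠ 1) (hχ2 : χ.IsQuadratic)
    (ψ : AddChar F K) (b : F) :
    ∑ x, χ x * ψ (x * b) = χ b * gaussSum χ ψ := by
  rcases eq_or_ne b 0 with rfl | hb
  · rw [MulChar.map_zero]
    simp [MulChar.sum_eq_zero_of_ne_one hχ]
  · have h := gaussSum_mulShift_eq χ ψ (Units.mk0 b hb)
    rw [hχ2.inv] at h
    simpa [gaussSum, mul_comm b] using h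

/-- Twice the Weil sum of exponent `(q + 1) / 2`, in terms of the quadratic Gauss sum. The exponent
is written `q / 2 + 1`, which agrees with `(q + 1) / 2` because `q` is odd. -/
theorem two_mul_sum_addChar_half [DecidableEq F] [CharZero K] (hF : ringChar F ≠ 2)
    {ψ : AddChar F K} (hψ : ψ.IsPrimitive) (a : F) :
    2 * ∑ x, ψ (x ^ (Fintype.card F / 2 + 1) - a * x) =
      (if 1 - a = 0 then (Fintype.card F : K) else 0)
        + (if -1 - a = 0 then (Fintype.card F : K) else 0)
        + (quadChar F K (1 - a) - quadChar F K (-1 - a)) * gaussSum (quadChar F K) ψ := by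
  -- Weighting the two shifts by `1 + η x` and `1 - η x` picks out `x ^ d = η x * x`; at `x = 0`,
  -- where `η x = 0`, both sides equal `2`.
  have key (x : F) : 2 * ψ (x ^ (Fintype.card F / 2 + 1) - a * x) =
      ψ (x * (1 - a)) + ψ (x * (-1 - a))
        + (quadChar F K x * ψ (x * (1 - a)) - quadChar F K x * ψ (x * (-1 - a))) := by
    rcases eq_or_ne x 0 with rfl | hx
    · simp [one_add_one_eq_two]
    · have hpow := quadraticChar_eq_pow_of_char_ne_two' hF x
      rw [pow_succ, ← hpow]
      rcases quadraticChar_dichotomy hx with h | h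
      · have e : x - a * x = x * (1 - a) := by ring
        simp only [quadChar, MulChar.ringHomComp_apply, h, e, Int.cast_one, one_mul, map_one]
        ring
      · have e : -1 * x - a * x = x * (-1 - a) := by ring
        simp only [quadChar, MulChar.ringHomComp_apply, h, e, Int.cast_neg, Int.cast_one,
          map_neg, map_one]
        ring
  rw [Finset.mul_sum, Finset.sum_congr rfl fun x _ => key x, Finset.sum_add_distrib,
    Finset.sum_add_distrib, Finset.sum_sub_distrib, AddChar.sum_mulShift _ hψ,
    AddChar.sum_mulShift _ hψ,
    sum_mulChar_mul_addChar_mul (quadChar_ne_one hF) quadChar_isQuadratic,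
    sum_mulChar_mul_addChar_mul (quadChar_ne_one hF) quadChar_isQuadratic]
  push_cast
  ring

end GaussSum

/-! ### The valuation at the prime above `p` -/

section Valuation

variable (p : ℕ) [hp : Fact p.Prime]

open WithZero

/-- The prime above `p` is totally ramified: `p` is a unit times `(ζ - 1) ^ (p - 1)`. -/
theorem valuation_natCast_self :
    (primeAbove p).valuation (cyclo p) (p : cyclo p) = exp (-((p : ℤ) - 1)) := by
  have hζ := zetaK_isPrimitiveRoot p
  have hπ : (primeAbove p).intValuation (zetaSubOne p) = exp (-1 : ℤ) :=
    (primeAbove p).intValuation_singleton (zetaSubOne_prime p).ne_zero rfl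
  obtain ⟨u, hu⟩ := IsCyclotomicExtension.Rat.associated_zeta_sub_one_pow_prime p hζ
  have hu1 : (primeAbove p).intValuation (u : 𝓞 (cyclo p)) = 1 := by
    have h1 := (primeAbove p).intValuation_le_one (u : 𝓞 (cyclo p))
    have h2 := (primeAbove p).intValuation_le_one ((u⁻¹ : (𝓞 (cyclo p))ˣ) : 𝓞 (cyclo p))
    refine le_antisymm h1 ?_
    calc (1 : ℤᵐ⁰) = (primeAbove p).intValuation (u * (u⁻¹ : (𝓞 (cyclo p))ˣ)) := by simp
      _ ≤ _ := by rw [map_mul]; exact mul_le_of_le_one_right' h2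
  have h : (primeAbove p).intValuation (p : 𝓞 (cyclo p)) = exp (-((p : ℤ) - 1)) := by
    rw [← hu, map_mul, map_pow, hu1, mul_one]
    change (primeAbove p).intValuation (zetaSubOne p) ^ (p - 1) = _
    rw [hπ, ← exp_nsmul]
    congr 1
    rw [nsmul_eq_mul, Nat.cast_sub hp.out.one_le]
    simp
  rw [← h, ← IsDedekindDomain.HeightOneSpectrum.valuation_of_algebraMap (K := cyclo p)]
  simp

theorem valuation_natCast_self_lt_one :
    (primeAbove p).valuation (cyclo p) (p : cyclo p) < 1 := by
  rw [valuation_natCast_self, ← exp_zero, exp_lt_exp]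
  have := hp.out.one_lt
  omega

theorem valuation_natCast_le_one (m : ℕ) :
    (primeAbove p).valuation (cyclo p) (m : cyclo p) ≤ 1 := by
  simpa using (primeAbove p).valuation_le_one (K := cyclo p) (m : 𝓞 (cyclo p))

variable {p}

/-- Both `p` and `2` having positive valuation would give `1 = p - 2 m` positive valuation. -/
theorem valuation_two (hodd : Odd p) : (primeAbove p).valuation (cyclo p) 2 = 1 := by
  have h2 := valuation_natCast_le_one p 2
  push_cast at h2
  refine h2.antisymm (not_lt.mp fun hlt => ?_)
  obtain ⟨m, hm⟩ := hodd
  have h1 : (1 : cyclo p) = p - 2 * m := by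
    have : (p : cyclo p) = 2 * m + 1 := by exact_mod_cast congrArg (Nat.cast (R := cyclo p)) hm
    rw [this]; ring
  have h2m : (primeAbove p).valuation (cyclo p) (2 * m : cyclo p) < 1 := by
    rw [map_mul]
    exact mul_lt_one_of_lt_of_le hlt (valuation_natCast_le_one p m)
  have := Valuation.map_sub_lt _ (valuation_natCast_self_lt_one p) h2m
  rw [← h1, map_one] at this
  exact lt_irrefl _ this

theorem valuation_mulChar_le_one {R : Type*} [CommRing R] {χ : MulChar R (cyclo p)}
    (hχ : χ.IsQuadratic) (a : R) : (primeAbove p).valuation (cyclo p) (χ a) ≤ 1 := by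
  rcases hχ a with h | h | h <;> simp [h]

theorem valuation_mulChar_unit {R : Type*} [CommRing R] {χ : MulChar R (cyclo p)}
    (hχ : χ.IsQuadratic) {a : R} (ha : IsUnit a) :
    (primeAbove p).valuation (cyclo p) (χ a) = 1 := by
  rcases hχ a with h | h | h
  · exact absurd h (ha.map χ).ne_zero
  all_goals simp [h]

theorem valp_le_valp {x y : cyclo p} (hy : y ≠ 0)
    (h : (primeAbove p).valuation (cyclo p) x ≤ (primeAbove p).valuation (cyclo p) y) :
    valp p y ≤ valp p x := by
  rcases eq_or_ne x 0 with rfl | hx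
  · simp [valp]
  rw [valp, valp, if_neg hx, if_neg hy, WithTop.coe_le_coe]
  have hlog := (log_le_log (by simpa using hx) (by simpa using hy)).mpr h
  have hp1 : (0 : ℚ) ≤ (p : ℚ) - 1 := by
    have : (1 : ℚ) ≤ p := by exact_mod_cast hp.out.one_le
    linarith
  gcongr

theorem valp_eq_half {x : cyclo p} {n : ℕ}
    (h : (primeAbove p).valuation (cyclo p) x ^ 2 =
      (primeAbove p).valuation (cyclo p) (p : cyclo p) ^ n) :
    valp p x = (((n : ℚ) / 2 : ℚ) : WithTop ℚ) := by
  rw [valuation_natCast_self] at h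
  have hx : x ≠ 0 := by
    rintro rfl
    rw [map_zero, zero_pow two_ne_zero] at h
    exact pow_ne_zero n exp_ne_zero h.symm
  have hlog := congrArg log h
  rw [log_pow, log_pow, log_exp] at hlog
  have hq := congrArg (Int.cast (R := ℚ)) hlog
  simp only [nsmul_eq_mul] at hq
  push_cast at hq
  have hp1 : (p : ℚ) - 1 ≠ 0 := by
    have : (1 : ℚ) < p := by exact_mod_cast hp.out.one_lt
    linarith
  rw [valp, if_neg hx, WithTop.coe_eq_coe]
  field_simp
  linarith

end Valuation

/-! ### The canonical character and the minimal valuation -/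

section Minimum

variable (p : ℕ) [hp : Fact p.Prime] (F : Type*) [Field F] [Algebra (ZMod p) F]

/-- The canonical additive character of `F`, with values in `ℚ(e^{2πi/p})`. -/
noncomputable def canonicalAddChar : AddChar F (cyclo p) :=
  (AddChar.zmodChar p (zetaK_isPrimitiveRoot p).pow_eq_one).compAddMonoidHom
    (Algebra.trace (ZMod p) F).toAddMonoidHom

theorem coe_canonicalAddChar (x : F) : (canonicalAddChar p F x : ℂ) = canonicalChar p x := by
  change zeta p ^ (Algebra.trace (ZMod p) F x).val = _
  rw [canonicalChar, zeta, ← Complex.exp_nat_mul]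
  congr 1
  ring

theorem canonicalAddChar_isPrimitive [Finite F] : (canonicalAddChar p F).IsPrimitive := by
  refine AddChar.IsPrimitive.of_ne_one fun h => ?_
  obtain ⟨x, hx⟩ := Algebra.trace_surjective (ZMod p) F 1
  have h1 : zetaK p ^ (1 : ZMod p).val = 1 := by
    rw [← hx]
    exact DFunLike.congr_fun h x
  rw [ZMod.val_one, pow_one] at h1
  exact (zetaK_isPrimitiveRoot p).ne_one hp.out.one_lt h1

variable {p F} [Fintype F]

theorem weilSum_eq_sum_canonicalAddChar (d : ℕ) (a : F) :
    (⟨weilSum p d a, weilSum_mem p d a⟩ : cyclo p) =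
      ∑ x, canonicalAddChar p F (x ^ d - a * x) := by
  apply Subtype.ext
  simp [weilSum, coe_canonicalAddChar]

/-- For `F` of order `p ^ n` with `p` odd, the Weil sums of exponent `(q + 1) / 2` have minimal
valuation `n / 2`, that of the quadratic Gauss sum, attained at `a = 1`. -/
theorem V_half (hodd : Odd p) {n : ℕ} (hcard : Fintype.card F = p ^ n) :
    V p F (Fintype.card F / 2 + 1) = (((n : ℚ) / 2 : ℚ) : WithTop ℚ) := by
  classical
  have hn : n ≠ 0 := by
    rintro rfl
    exact Fintype.one_lt_card.ne' (hcard.trans (pow_zero p))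
  have : CharP F p := charP_of_injective_algebraMap (algebraMap (ZMod p) F).injective p
  have hF : ringChar F ≠ 2 := by
    rw [ringChar.eq F p]
    rintro rfl
    exact absurd hodd (by decide)
  set v := (primeAbove p).valuation (cyclo p) with hv
  set ψ := canonicalAddChar p F
  set η := quadChar F (cyclo p)
  set G := gaussSum η ψ
  have hη : η.IsQuadratic := quadChar_isQuadratic
  have hψ : ψ.IsPrimitive := canonicalAddChar_isPrimitive p F
  have hvq : v (Fintype.card F : cyclo p) = v p ^ n := by
    rw [hcard, Nat.cast_pow, map_pow]
  have hvG : v G ^ 2 = v p ^ n := by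
    rw [← map_pow, gaussSum_sq (quadChar_ne_one hF) hη hψ, map_mul,
      valuation_mulChar_unit hη isUnit_one.neg, one_mul, hvq]
  have hq1 : v (p : cyclo p) ^ n < 1 := pow_lt_one' (valuation_natCast_self_lt_one p) hn
  have hG1 : v G < 1 := by
    rw [← hvG] at hq1
    exact lt_of_not_ge fun h => absurd hq1 (not_lt.mpr (one_le_pow_of_one_le' h 2))
  have hG0 : v G ≠ 0 := fun h => by
    rw [h, zero_pow two_ne_zero, valuation_natCast_self] at hvG
    exact pow_ne_zero n WithZero.exp_ne_zero hvG.symm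
  have hqG : v (Fintype.card F : cyclo p) < v G := by
    rw [hvq, ← hvG, pow_two]
    exact mul_lt_of_lt_one_right (zero_lt_iff.mpr hG0) hG1
  have hG_ne : G ≠ 0 := fun h => hG0 (by rw [h, map_zero])
  have hval (a : F) : v (∑ x, ψ (x ^ (Fintype.card F / 2 + 1) - a * x)) =
      v ((if 1 - a = 0 then (Fintype.card F : cyclo p) else 0)
        + (if -1 - a = 0 then (Fintype.card F : cyclo p) else 0)
        + (η (1 - a) - η (-1 - a)) * G) := by
    rw [← two_mul_sum_addChar_half hF hψ, map_mul, hv, valuation_two hodd, one_mul]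
  have hle (a : F) : v (∑ x, ψ (x ^ (Fintype.card F / 2 + 1) - a * x)) ≤ v G := by
    have hite (b : F) : v (if b = 0 then (Fintype.card F : cyclo p) else 0) ≤ v G := by
      split_ifs
      · exact hqG.le
      · simp
    rw [hval]
    refine Valuation.map_add_le _ (Valuation.map_add_le _ (hite _) (hite _)) ?_
    rw [map_mul]
    exact mul_le_of_le_one_left' (Valuation.map_sub_le _
      (valuation_mulChar_le_one hη _) (valuation_mulChar_le_one hη _))
  -- At `a = 1` the term of valuation `v G` survives, because `η 0 = 0` and `η (-2) ≠ 0`.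
  have heq : v (∑ x, ψ (x ^ (Fintype.card F / 2 + 1) - 1 * x)) = v G := by
    have h2 : (-1 - 1 : F) ≠ 0 := by
      rw [← neg_add', neg_ne_zero, one_add_one_eq_two]
      exact Ring.two_ne_zero hF
    have hηG : v (η (-1 - 1) * G) = v G := by
      rw [map_mul, valuation_mulChar_unit hη (isUnit_iff_ne_zero.mpr h2), one_mul]
    rw [hval, sub_self, if_pos rfl, if_neg h2, MulChar.map_zero, add_zero, zero_sub, neg_mul,
      ← sub_eq_add_neg, Valuation.map_sub_eq_of_lt_right _ (hqG.trans_eq hηG.symm), hηG]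
  have hVG : valp p G = (((n : ℚ) / 2 : ℚ) : WithTop ℚ) := valp_eq_half hvG
  rw [V]
  apply le_antisymm
  · refine (Finset.inf'_le _ (Finset.mem_univ (1 : F))).trans ?_
    rw [weilSum_eq_sum_canonicalAddChar]
    exact (valp_eq_half ((congrArg (· ^ 2) heq).trans hvG)).le
  · refine Finset.le_inf' _ _ fun a _ => ?_
    rw [weilSum_eq_sum_canonicalAddChar, ← hVG]
    exact valp_le_valp hG_ne (hle a)

end Minimum

end WeilBinomial

theorem lemma5p5 (p n q d : ℕ) [Fact p.Prime] (hp : Odd p)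
    (F : Type*) [Field F] [Fintype F] [Algebra (ZMod p) F]
    (hF : Fintype.card F = q) (hq : q = p ^ n) (hd : d = (q + 1) / 2) :
    (d ≡ 1 [MOD p - 1] ↔ Even n) ∧
    (Nat.gcd d (q - 1) = 1 ↔ q ≡ 1 [MOD 4]) ∧
    (Nat.gcd d (q - 1) = 1 → WeilBinomial.V p F d = (((n : ℚ) / 2 : ℚ) : WithTop ℚ)) := by
  have hodd : Odd q := hq ▸ hp.pow
  refine ⟨?_, ?_, fun _ => ?_⟩
  · rw [hd, hq]
    exact WeilBinomial.half_succ_pow_modEq_one_iff hp (Fact.out : p.Prime).one_lt n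
  · rw [hd]
    exact WeilBinomial.gcd_half_succ_eq_one_iff hodd
  · have hd' : d = Fintype.card F / 2 + 1 := by
      obtain ⟨k, hk⟩ := hodd
      omega
    rw [hd']
    exact WeilBinomial.V_half hp (hF.trans hq)
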